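/- For integers $k\ge 2$ and $n\ge 1$, a set $C\subseteq\{1,\dots,k\}^n$ is called a perfect $k$-hash code of length $n$ if for any $k$ distinct elements of $C$ there exists a coordinate in which they are pairwise different. Let $N_k(n)$ be the largest cardinality of a perfect $k$-hash code of length $n$, and put $$R_k=\limsup_{n\to\infty}\frac{\log_2 N_k(n)}{n}.$$ Then $R_5\le 0.1697$ and $R_6\le 0.0875$. -/

import Mathlib

/-- A set `C` of words of length `n` over an alphabet of size `k` is a perfect `k`-hash code if
for any `k` distinct elements of `C` there is a coordinate where they all differ. -/
def IsPerfectHash (k n : ℕ) (C : Finset (Fin n → Fin k)) : Prop :=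
  ∀ x : Fin k → (Fin n → Fin k), Function.Injective x → (∀ j, x j ∈ C) →
    ∃ i : Fin n, Function.Injective (fun j => x j i)

open Classical in
/-- The largest cardinality of a perfect `k`-hash code of length `n`. -/
noncomputable def maxHashSize (k n : ℕ) : ℕ :=
  (Finset.univ.filter (IsPerfectHash k n)).sup Finset.card

/-- The rate (with logarithm in base two) of the largest perfect `k`-hash codes of length `n`. -/
noncomputable def maxHashRate (k n : ℕ) : ℝ :=
  Real.logb 2 (maxHashSize k n : ℝ) / (n : ℝ)

/-- `R_k`: the limsup, as the length tends to infinity, of the rate of the largest perfect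
`k`-hash codes. The sequence is bounded (see `maxHashRate_nonneg` and `maxHashRate_le`), so this
real-valued `limsup` is the usual one. -/
noncomputable def hashRate (k : ℕ) : ℝ :=
  Filter.limsup (fun n : ℕ => maxHashRate k n) Filter.atTop

theorem maxHashRate_nonneg (k n : ℕ) : 0 ≤ maxHashRate k n := by
  unfold maxHashRate
  refine div_nonneg ?_ (Nat.cast_nonneg n)
  rcases Nat.eq_zero_or_pos (maxHashSize k n) with h | h
  · simp [h]
  · exact Real.logb_nonneg (by norm_num) (by exact_mod_cast h)

theorem maxHashSize_le (k n : ℕ) : maxHashSize k n ≤ k ^ n := by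
  unfold maxHashSize
  refine Finset.sup_le fun C _ => ?_
  simpa using Finset.card_le_univ C

theorem maxHashRate_le (k n : ℕ) : maxHashRate k n ≤ Real.logb 2 (k : ℝ) := by
  have hk : 0 ≤ Real.logb 2 (k : ℝ) := by
    rcases Nat.eq_zero_or_pos k with h | h
    · simp [h]
    · exact Real.logb_nonneg (by norm_num) (by exact_mod_cast h)
  unfold maxHashRate
  rcases Nat.eq_zero_or_pos n with hn | hn
  · simpa [hn] using hk
  rcases Nat.eq_zero_or_pos (maxHashSize k n) with h | h
  · simpa [h] using hk
  have hn' : (0 : ℝ) < n := by exact_mod_cast hn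
  rw [div_le_iff₀ hn', mul_comm, ← Real.logb_pow]
  refine Real.logb_le_logb_of_le (by norm_num) (by exact_mod_cast h) ?_
  exact_mod_cast maxHashSize_le k n

/-! Write `k = m + 2` and let `C` be a code of size `N`. Once `m` codewords are fixed, any two of
the other words must, at some coordinate, show the two symbols left free by the fixed words. Such
coordinates cover the complete graph on the remaining words by bipartite graphs, so Hansel's lemma
bounds `N log₂ N`, up to lower-order corrections, by the total number of non-isolated vertices
(`IsPerfectHash.card_sub_mul_logb_le`).

The `m` words are drawn from a subcode `B` that uses fewer than `m` symbols at each coordinate of a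
set `J`. By pigeonhole the coordinates in `J` then contribute nothing. At any other coordinate the
average contribution is governed by `hashForm m p q`, where `p` and `q` are the symbol distributions
of `B` and `C` (`IsPerfectHash.sum_subcode_le`).

For a single pair `(p, q)` the form can exceed its value `M` at the uniform distributions. However,
`B` ranges over all boxes on `J`, and with weights `#B` the mean of `p` is `q`. Hence `α (⟨p, q⟩ -
⟨q, q⟩)` may be added at no cost, and with this term the bound `M` holds pointwise
(`hashForm_three_le`, `hashForm_four_le`). This gives roughly `log₂ N ≤ M (n - #J)`, provided the
boxes are large on average; this limits `#J` to a fraction of `n` depending on the rate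
(`eventually_card_le_two_rpow`). -/

/-! ### Hansel's lemma and its application to hash codes. -/

open Finset in
/-- Kraft-type inequality: if any two members of `V` carry opposite labels at some coordinate
where both are labelled, then `∑ 2 ^ (-(number of labels))` is at most one. -/
theorem sum_two_pow_neg_labels_le_one {α ι : Type*} [Fintype ι] [DecidableEq ι] (V : Finset α)
    (g : α → ι → Option Bool)
    (hg : ∀ y ∈ V, ∀ z ∈ V, y ≠ z → ∃ i b, g y i = some b ∧ g z i = some (!b)) :
    ∑ y ∈ V, ((2 : ℝ) ^ #{i | (g y i).isSome})⁻¹ ≤ 1 := by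
  classical
  -- `cyl y` is the subcube of sign vectors extending the labels of `y`. Opposite labels make
  -- subcubes disjoint, and their total size is at most that of the cube.
  let cyl : α → Finset (ι → Bool) := fun y =>
    Fintype.piFinset fun i => univ.filter fun b => ∀ b', g y i = some b' → b = b'
  have hcard : ∀ y, (#(cyl y) : ℝ) = 2 ^ Fintype.card ι * ((2 : ℝ) ^ #{i | (g y i).isSome})⁻¹ := by
    intro y
    have h1 : #(cyl y) = ∏ i, if (g y i).isSome then 1 else 2 := by
      rw [Fintype.card_piFinset]
      refine prod_congr rfl fun i _ => ?_
      rcases h : g y i with _ | b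
      · simp
      · simp [Finset.filter_eq']
    have h2 : #(cyl y) * 2 ^ #{i | (g y i).isSome} = 2 ^ Fintype.card ι := by
      rw [h1, prod_ite, prod_const_one, one_mul, prod_const, ← pow_add]
      congr 1
      rw [add_comm, card_filter_add_card_filter_not]
      rfl
    rw [eq_mul_inv_iff_mul_eq₀ (by positivity)]
    exact_mod_cast h2
  have hdisj : (V : Set α).PairwiseDisjoint cyl := by
    intro y hy z hz hyz
    rw [Function.onFun, Finset.disjoint_left]
    intro s hs hs'
    obtain ⟨i, b, h1, h2⟩ := hg y hy z hz hyz
    simp only [cyl, Fintype.mem_piFinset, mem_filter, mem_univ, true_and] at hs hs'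
    have := (hs i b h1).symm.trans (hs' i _ h2)
    cases b <;> simp at this
  have htot : (∑ y ∈ V, (#(cyl y) : ℝ)) ≤ 2 ^ Fintype.card ι := by
    have := card_le_univ (V.biUnion cyl)
    rw [card_biUnion hdisj] at this
    simp only [Fintype.card_fun, Fintype.card_bool] at this
    exact_mod_cast this
  simp only [hcard, ← mul_sum] at htot
  exact le_of_mul_le_mul_left (by simpa using htot) (by positivity : (0:ℝ) < 2 ^ Fintype.card ι)

open Finset in
/-- **Hansel's lemma**: covering the complete graph on `V` by bipartite graphs (encoded by the
labels `g · i`) takes at least `|V| log₂ |V|` non-isolated vertices. -/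
theorem card_mul_logb_card_le_sum_labels {α ι : Type*} [Fintype ι] [DecidableEq ι] (V : Finset α)
    (g : α → ι → Option Bool)
    (hg : ∀ y ∈ V, ∀ z ∈ V, y ≠ z → ∃ i b, g y i = some b ∧ g z i = some (!b)) :
    (#V : ℝ) * Real.logb 2 #V ≤ ∑ y ∈ V, (#{i | (g y i).isSome} : ℝ) := by
  rcases V.eq_empty_or_nonempty with rfl | hV
  · simp
  have hv : (0 : ℝ) < #V := by exact_mod_cast hV.card_pos
  have hlog2 : 0 < Real.log 2 := Real.log_pos (by norm_num)
  -- The tangent bound `log x ≤ x - 1` at `x = #V * 2 ^ (-labels)` plays the role of Jensen's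
  -- inequality.
  have key : ∀ y ∈ V, 1 + Real.log #V - #{i | (g y i).isSome} * Real.log 2 ≤
      #V * ((2 : ℝ) ^ #{i | (g y i).isSome})⁻¹ := by
    intro y _
    have hpos : (0 : ℝ) < #V * ((2 : ℝ) ^ #{i | (g y i).isSome})⁻¹ := by positivity
    have := Real.log_le_sub_one_of_pos hpos
    rw [Real.log_mul hv.ne' (by positivity), Real.log_inv, Real.log_pow] at this
    linarith
  have h := sum_le_sum key
  rw [← mul_sum] at h
  have h' := mul_le_mul_of_nonneg_left (sum_two_pow_neg_labels_le_one V g hg) hv.le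
  simp only [sum_sub_distrib, sum_const, nsmul_eq_mul, ← sum_mul] at h
  rw [Real.logb, mul_div_assoc', div_le_iff₀ hlog2]
  linarith

open Finset in
/-- Hansel's lemma applied to the words of a perfect hash code other than `x 0, …, x (m - 1)`. -/
theorem IsPerfectHash.card_sub_mul_logb_le {m n : ℕ} {C : Finset (Fin n → Fin (m + 2))}
    (hC : IsPerfectHash (m + 2) n C) (x : Fin m → Fin n → Fin (m + 2))
    (hx : Function.Injective x) (hxC : ∀ j, x j ∈ C) :
    ((#C : ℝ) - m) * Real.logb 2 ((#C : ℝ) - m) ≤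
      ∑ i, if Function.Injective (fun j => x j i) then (#{y ∈ C | ∀ j, y i ≠ x j i} : ℝ) else 0 := by
  classical
  set V := C \ univ.image x with hV
  have hcard : (#V : ℝ) = #C - m := by
    have h1 : univ.image x ⊆ C := by
      intro y hy
      obtain ⟨j, _, rfl⟩ := mem_image.1 hy
      exact hxC j
    rw [hV, cast_card_sdiff h1, card_image_of_injective _ hx]
    simp
  -- A word is labelled at `i` when the fixed words differ pairwise there and it avoids their
  -- symbols. Two symbols are then free, and the label records whether the word has the smaller one.
  let g : (Fin n → Fin (m + 2)) → Fin n → Option Bool := fun y i =>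
    if Function.Injective (fun j => x j i) ∧ ∀ j, y i ≠ x j i then
      some (decide (∀ a : Fin (m + 2), (∀ j, a ≠ x j i) → y i ≤ a)) else none
  have hg : ∀ y ∈ V, ∀ z ∈ V, y ≠ z → ∃ i b, g y i = some b ∧ g z i = some (!b) := by
    intro y hy z hz hyz
    rw [hV, mem_sdiff] at hy hz
    have hyx : ∀ j, x j ≠ y := fun j h => hy.2 (mem_image.2 ⟨j, mem_univ _, h⟩)
    have hzx : ∀ j, x j ≠ z := fun j h => hz.2 (mem_image.2 ⟨j, mem_univ _, h⟩)
    have hinj : Function.Injective (Fin.cons y (Fin.cons z x : Fin (m + 1) → _) :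
        Fin (m + 2) → Fin n → Fin (m + 2)) := by
      rw [Fin.cons_injective_iff, Fin.cons_injective_iff]
      refine ⟨?_, ?_, hx⟩
      · rintro ⟨j, hj⟩
        induction j using Fin.cases with
        | zero => exact hyz hj.symm
        | succ j => exact hyx j hj
      · rintro ⟨j, hj⟩
        exact hzx j hj
    obtain ⟨i, hi⟩ := hC _ hinj (by
      intro j
      induction j using Fin.cases with
      | zero => exact hy.1
      | succ j =>
        induction j using Fin.cases with
        | zero => exact hz.1
        | succ j => exact hxC j)
    have hsurj := Finite.surjective_of_injective hi
    have hxi : Function.Injective (fun j => x j i) := fun j j' h => by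
      have := @hi j.succ.succ j'.succ.succ (by simpa using h)
      simpa using this
    have hyi : ∀ j, y i ≠ x j i := fun j h => by
      have := @hi 0 j.succ.succ (by simpa using h)
      exact absurd this (Fin.succ_ne_zero _).symm
    have hzi : ∀ j, z i ≠ x j i := fun j h => by
      have := @hi (Fin.succ 0) j.succ.succ (by simpa using h)
      exact absurd (Fin.succ_injective _ this) (Fin.succ_ne_zero _).symm
    have hyzi : y i ≠ z i := fun h => by
      have := @hi 0 (Fin.succ 0) (by simpa using h)
      exact absurd this (Fin.succ_ne_zero _).symm
    have hall : ∀ a, (∀ j, a ≠ x j i) → a = y i ∨ a = z i := by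
      intro a ha
      obtain ⟨j, rfl⟩ := hsurj a
      induction j using Fin.cases with
      | zero => left; rfl
      | succ j =>
        induction j using Fin.cases with
        | zero => right; rfl
        | succ j => exact absurd rfl (ha j)
    rcases lt_or_gt_of_ne hyzi with h | h
    · refine ⟨i, true, ?_, ?_⟩
      · simp only [g, if_pos (And.intro hxi hyi), Option.some.injEq, decide_eq_true_eq]
        intro a ha
        rcases hall a ha with rfl | rfl
        · exact le_rfl
        · exact h.le
      · simp only [g, if_pos (And.intro hxi hzi), Option.some.injEq, Bool.not_true,
          decide_eq_false_iff_not]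
        exact fun h' => absurd (h' _ hyi) (not_le.2 h)
    · refine ⟨i, false, ?_, ?_⟩
      · simp only [g, if_pos (And.intro hxi hyi), Option.some.injEq, decide_eq_false_iff_not]
        exact fun h' => absurd (h' _ hzi) (not_le.2 h)
      · simp only [g, if_pos (And.intro hxi hzi), Option.some.injEq, Bool.not_false,
          decide_eq_true_eq]
        intro a ha
        rcases hall a ha with rfl | rfl
        · exact h.le
        · exact le_rfl
  have hsome : ∀ y i, (g y i).isSome ↔
      Function.Injective (fun j => x j i) ∧ ∀ j, y i ≠ x j i := by
    intro y i
    simp only [g]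
    split_ifs with h <;> simp [h]
  have h := card_mul_logb_card_le_sum_labels V g hg
  rw [hcard] at h
  refine h.trans ?_
  have hswap : ∑ y ∈ V, (#{i | (g y i).isSome} : ℝ) = ∑ i, (#{y ∈ V | (g y i).isSome} : ℝ) := by
    simp only [card_filter, Nat.cast_sum]
    exact sum_comm
  rw [hswap]
  refine sum_le_sum fun i _ => ?_
  simp only [hsome]
  split_ifs with hi
  · simp only [hi, true_and]
    exact_mod_cast card_le_card (filter_subset_filter _ sdiff_subset)
  · simp [hi]

/-! ### Maximising a quadratic over a hyperplane. -/

open Finset in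
/-- A concave quadratic on the hyperplane `∑ q = 1` is at most its unconstrained maximum. -/
theorem sum_mul_sub_sum_sq_le {ι : Type*} [Fintype ι] [Nonempty ι] {α : ℝ} (hα : 0 < α)
    (q v : ι → ℝ) (hq : ∑ i, q i = 1) :
    ∑ i, q i * v i - α * ∑ i, q i ^ 2 ≤
      (∑ i, v i - α) / Fintype.card ι +
        (∑ i, v i ^ 2 - (∑ i, v i) ^ 2 / Fintype.card ι) / (4 * α) := by
  set k : ℝ := (Fintype.card ι : ℝ) with hk
  have hkpos : 0 < k := by rw [hk]; exact_mod_cast Fintype.card_pos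
  set S := ∑ i, v i with hS
  -- Each squared term is `2 * α` times the deviation of `q i` from the Lagrange critical point `(v
  -- i - (S - 2 * α) / k) / (2 * α)`.
  have h : 0 ≤ ∑ i, (2 * α * q i - v i + (S - 2 * α) / k) ^ 2 := by positivity
  have hexp : ∑ i, (2 * α * q i - v i + (S - 2 * α) / k) ^ 2 =
      4 * α ^ 2 * ∑ i, q i ^ 2 + ∑ i, v i ^ 2 + k * ((S - 2 * α) / k) ^ 2 -
        4 * α * ∑ i, q i * v i + 4 * α * ((S - 2 * α) / k) * ∑ i, q i -
        2 * ((S - 2 * α) / k) * ∑ i, v i := by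
    have : k * ((S - 2 * α) / k) ^ 2 = ∑ _i : ι, ((S - 2 * α) / k) ^ 2 := by
      simp [hk]
    rw [this]
    simp only [mul_sum, ← sum_add_distrib, ← sum_sub_distrib]
    exact sum_congr rfl fun i _ => by ring
  rw [hexp, hq, ← hS] at h
  have h4 : (∑ i, q i * v i - α * ∑ i, q i ^ 2) * (4 * α) ≤
      ((S - α) / k + (∑ i, v i ^ 2 - S ^ 2 / k) / (4 * α)) * (4 * α) := by
    have e : ((S - α) / k + (∑ i, v i ^ 2 - S ^ 2 / k) / (4 * α)) * (4 * α) =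
        4 * α * (S - α) / k + (∑ i, v i ^ 2 - S ^ 2 / k) := by
      field_simp
    rw [e]
    have e2 : k * ((S - 2 * α) / k) ^ 2 + 4 * α * ((S - 2 * α) / k) - 2 * ((S - 2 * α) / k) * S =
        4 * α * (S - α) / k - S ^ 2 / k := by
      field_simp
      ring
    linarith
  exact le_of_mul_le_mul_right h4 (by positivity)

/-! ### The hash form and its explicit expansions for five and six symbols. -/

/-- The form `∑ p (s 0) ⋯ p (s (m - 1)) q a` over all `m + 1` pairwise distinct symbols
`s 0, …, s (m - 1), a`. -/
noncomputable def hashForm (m : ℕ) (p q : Fin (m + 2) → ℝ) : ℝ :=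
  ∑ s : Fin m → Fin (m + 2),
    if Function.Injective s then (∏ j, p (s j)) * ∑ a with ∀ j, a ≠ s j, q a else 0

open Finset in
theorem sum_injective_eq_factorial_mul {α : Type*} [Fintype α] [DecidableEq α] (m : ℕ)
    (f : Finset α → ℝ) :
    ∑ s : Fin m → α with Function.Injective s, f (univ.image s) =
      m.factorial * ∑ S ∈ powersetCard m univ, f S := by
  have hmaps : ∀ s ∈ (univ.filter fun s : Fin m → α => Function.Injective s),
      univ.image s ∈ powersetCard m (univ : Finset α) := by
    intro s hs
    rw [mem_powersetCard_univ, card_image_of_injective _ (mem_filter.1 hs).2]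
    simp
  rw [← sum_fiberwise_of_maps_to hmaps, mul_sum]
  refine sum_congr rfl fun S hS => ?_
  have hS' : #S = m := (mem_powersetCard.1 hS).2
  have hcongr : ∀ s ∈ ((univ.filter fun s : Fin m → α => Function.Injective s).filter
      fun s => univ.image s = S), f (univ.image s) = f S := fun s hs => by
    rw [(mem_filter.1 hs).2]
  rw [sum_congr rfl hcongr, sum_const, nsmul_eq_mul]
  congr 2
  have hcard : Fintype.card (Fin m ↪ S) = m.factorial := by
    rw [Fintype.card_embedding_eq, Fintype.card_fin, Fintype.card_coe, hS',
      Nat.descFactorial_self]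
  rw [← hcard, ← card_univ]
  symm
  refine card_bij (fun e _ j => (e j : α)) ?_ ?_ ?_
  · intro e _
    have hinj : Function.Injective fun j => (e j : α) := Subtype.val_injective.comp e.injective
    refine mem_filter.2 ⟨mem_filter.2 ⟨mem_univ _, hinj⟩, ?_⟩
    refine eq_of_subset_of_card_le ?_ ?_
    · intro a ha
      obtain ⟨j, _, rfl⟩ := mem_image.1 ha
      exact (e j).2
    · rw [card_image_of_injective _ hinj, hS']
      simp
  · intro e _ e' _ h
    ext j
    exact congrFun h j
  · intro s hs
    rw [mem_filter, mem_filter] at hs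
    refine ⟨⟨fun j => ⟨s j, ?_⟩, fun j j' h => hs.1.2 (congrArg Subtype.val h)⟩, mem_univ _, rfl⟩
    rw [← hs.2]
    exact mem_image_of_mem _ (mem_univ _)

open Finset in
theorem hashForm_eq (m : ℕ) (p q : Fin (m + 2) → ℝ) :
    hashForm m p q = m.factorial *
      ∑ S ∈ powersetCard m (univ : Finset (Fin (m + 2))), (∏ a ∈ S, p a) * ∑ a ∈ Sᶜ, q a := by
  rw [← sum_injective_eq_factorial_mul m fun S => (∏ a ∈ S, p a) * ∑ a ∈ Sᶜ, q a, hashForm,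
    sum_filter]
  refine sum_congr rfl fun s _ => ?_
  split_ifs with hs
  · rw [prod_image fun a _ b _ h => hs h]
    congr 2
    ext a
    simp [eq_comm]
  · rfl

open Finset in
theorem hashForm_three (p q : Fin 5 → ℝ) :
    hashForm 3 p q = 6 *
      (p 0 * p 1 * p 2 * (q 3 + q 4) +
       p 0 * p 1 * p 3 * (q 2 + q 4) +
       p 0 * p 1 * p 4 * (q 2 + q 3) +
       p 0 * p 2 * p 3 * (q 1 + q 4) +
       p 0 * p 2 * p 4 * (q 1 + q 3) +
       p 0 * p 3 * p 4 * (q 1 + q 2) +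
       p 1 * p 2 * p 3 * (q 0 + q 4) +
       p 1 * p 2 * p 4 * (q 0 + q 3) +
       p 1 * p 3 * p 4 * (q 0 + q 2) +
       p 2 * p 3 * p 4 * (q 0 + q 1)) := by
  have hP : powersetCard 3 (univ : Finset (Fin 5)) =
      {{0, 1, 2}, {0, 1, 3}, {0, 1, 4}, {0, 2, 3}, {0, 2, 4}, {0, 3, 4}, {1, 2, 3}, {1, 2, 4},
       {1, 3, 4}, {2, 3, 4}} := by decide
  -- Complement sums become total minus sum over `S`, so only explicitly listed sets need
  -- evaluating.
  have hc : ∀ S : Finset (Fin 5), ∑ a ∈ Sᶜ, q a = ∑ a, q a - ∑ a ∈ S, q a := fun S =>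
    eq_sub_of_add_eq (sum_compl_add_sum S q)
  rw [hashForm_eq]
  simp only [hc, hP]
  repeat rw [sum_insert (by decide)]
  simp [Fin.sum_univ_succ, Nat.factorial]
  ring

open Finset in
theorem hashForm_four (p q : Fin 6 → ℝ) :
    hashForm 4 p q = 24 *
      (p 0 * p 1 * p 2 * p 3 * (q 4 + q 5) +
       p 0 * p 1 * p 2 * p 4 * (q 3 + q 5) +
       p 0 * p 1 * p 2 * p 5 * (q 3 + q 4) +
       p 0 * p 1 * p 3 * p 4 * (q 2 + q 5) +
       p 0 * p 1 * p 3 * p 5 * (q 2 + q 4) +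
       p 0 * p 1 * p 4 * p 5 * (q 2 + q 3) +
       p 0 * p 2 * p 3 * p 4 * (q 1 + q 5) +
       p 0 * p 2 * p 3 * p 5 * (q 1 + q 4) +
       p 0 * p 2 * p 4 * p 5 * (q 1 + q 3) +
       p 0 * p 3 * p 4 * p 5 * (q 1 + q 2) +
       p 1 * p 2 * p 3 * p 4 * (q 0 + q 5) +
       p 1 * p 2 * p 3 * p 5 * (q 0 + q 4) +
       p 1 * p 2 * p 4 * p 5 * (q 0 + q 3) +
       p 1 * p 3 * p 4 * p 5 * (q 0 + q 2) +
       p 2 * p 3 * p 4 * p 5 * (q 0 + q 1)) := by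
  have hP : powersetCard 4 (univ : Finset (Fin 6)) =
      {{0, 1, 2, 3}, {0, 1, 2, 4}, {0, 1, 2, 5}, {0, 1, 3, 4}, {0, 1, 3, 5}, {0, 1, 4, 5},
       {0, 2, 3, 4}, {0, 2, 3, 5}, {0, 2, 4, 5}, {0, 3, 4, 5}, {1, 2, 3, 4}, {1, 2, 3, 5},
       {1, 2, 4, 5}, {1, 3, 4, 5}, {2, 3, 4, 5}} := by decide
  have hc : ∀ S : Finset (Fin 6), ∑ a ∈ Sᶜ, q a = ∑ a, q a - ∑ a ∈ S, q a := fun S =>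
    eq_sub_of_add_eq (sum_compl_add_sum S q)
  rw [hashForm_eq]
  simp only [hc, hP]
  repeat rw [sum_insert (by decide)]
  simp [Fin.sum_univ_succ, Nat.factorial]
  ring

/-! ### Quadratic certificates for the hash form. -/

/-- With `σ = a * b + a * c + b * c`, the constant terms cancel and `3 * σ ≤ a + b + c` leaves at
least `27 / 25 * σ - 15 / 8 * σ ^ 2`, which is nonnegative because `σ ≤ 1 / 3`. -/
theorem pair_weight_three {a b c : ℝ} (ha : 0 ≤ a) (hb : 0 ≤ b) (hc : 0 ≤ c)
    (h : a + b + c ≤ 1) :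
    0 ≤ 6 / 125 + 4 / 25 * (a + b + c) -
      5 / 96 * ((24 / 25) - 6 * (a * b + a * c + b * c)) ^ 2 := by
  have h0 : 0 ≤ a * b + a * c + b * c := by positivity
  have h1 : 3 * (a * b + a * c + b * c) ≤ a + b + c := by
    nlinarith [sq_nonneg (a - b), sq_nonneg (a - c), sq_nonneg (b - c)]
  nlinarith

theorem pair_weight_four {a b c d : ℝ} (ha : 0 ≤ a) (hb : 0 ≤ b) (hc : 0 ≤ c) (hd : 0 ≤ d)
    (h : a + b + c + d ≤ 1) :
    0 ≤ 1 / 54 + 1 / 18 * (a + b + c + d) +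
        1 / 3 * (a * b + a * c + a * d + b * c + b * d + c * d) -
      3 / 32 *
        ((4 / 9) - 24 * (a * b * c + a * b * d + a * c * d + b * c * d)) ^ 2 := by
  set e₂ := a * b + a * c + a * d + b * c + b * d + c * d with he₂
  set e₃ := a * b * c + a * b * d + a * c * d + b * c * d with he₃
  have h2 : 0 ≤ e₂ := by positivity
  have h3 : 0 ≤ e₃ := by positivity
  have h32 : 6 * e₃ ≤ (a + b + c + d) * e₂ := by
    nlinarith [mul_nonneg ha (sq_nonneg (b - c)), mul_nonneg ha (sq_nonneg (b - d)),
      mul_nonneg ha (sq_nonneg (c - d)), mul_nonneg hb (sq_nonneg (a - c)),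
      mul_nonneg hb (sq_nonneg (a - d)), mul_nonneg hb (sq_nonneg (c - d)),
      mul_nonneg hc (sq_nonneg (a - b)), mul_nonneg hc (sq_nonneg (a - d)),
      mul_nonneg hc (sq_nonneg (b - d)), mul_nonneg hd (sq_nonneg (a - b)),
      mul_nonneg hd (sq_nonneg (a - c)), mul_nonneg hd (sq_nonneg (b - c))]
  have h32' : 6 * e₃ ≤ e₂ := h32.trans (mul_le_of_le_one_left h2 h)
  have h21 : 8 * e₂ ≤ 3 := by
    have : 8 * e₂ ≤ 3 * (a + b + c + d) ^ 2 := by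
      nlinarith [sq_nonneg (a - b), sq_nonneg (a - c), sq_nonneg (a - d), sq_nonneg (b - c),
        sq_nonneg (b - d), sq_nonneg (c - d)]
    have h1 : (a + b + c + d) ^ 2 ≤ 1 := pow_le_one₀ (by positivity) h
    linarith
  -- The constants cancel again. Since `e₂ / 3 ≥ 2 * e₃`, what remains is at least `4 * e₃ - 54 * e₃
  -- ^ 2`, and `h32'` with `h21` gives `16 * e₃ ≤ 1`.
  nlinarith [mul_nonneg h3 (by linarith : 0 ≤ 1 - 16 * e₃)]

/-- `24 / 125` minus the cubic symmetric function is a sum of `(a - b) ^ 2` with weights that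
dominate those of the variance term, pair by pair. -/
theorem weighted_esymm_three_le {a b c d e : ℝ} (ha : 0 ≤ a) (hb : 0 ≤ b) (hc : 0 ≤ c)
    (hd : 0 ≤ d) (he : 0 ≤ e) (h : a + b + c + d + e = 1) :
    12 / 5 * (
        a * b * c + a * b * d + a * b * e + a * c * d + a * c * e + a * d * e + b * c * d +
        b * c * e + b * d * e + c * d * e) +
      5 / 96 * (
        ((a - b) * ((24 / 25) - 6 * (c * d + c * e + d * e))) ^ 2 +
        ((a - c) * ((24 / 25) - 6 * (b * d + b * e + d * e))) ^ 2 +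
        ((a - d) * ((24 / 25) - 6 * (b * c + b * e + c * e))) ^ 2 +
        ((a - e) * ((24 / 25) - 6 * (b * c + b * d + c * d))) ^ 2 +
        ((b - c) * ((24 / 25) - 6 * (a * d + a * e + d * e))) ^ 2 +
        ((b - d) * ((24 / 25) - 6 * (a * c + a * e + c * e))) ^ 2 +
        ((b - e) * ((24 / 25) - 6 * (a * c + a * d + c * d))) ^ 2 +
        ((c - d) * ((24 / 25) - 6 * (a * b + a * e + b * e))) ^ 2 +
        ((c - e) * ((24 / 25) - 6 * (a * b + a * d + b * d))) ^ 2 +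
        ((d - e) * ((24 / 25) - 6 * (a * b + a * c + b * c))) ^ 2) ≤ 24 / 125 := by
  have hab := mul_nonneg (sq_nonneg (a - b))
    (pair_weight_three hc hd he (by linarith))
  have hac := mul_nonneg (sq_nonneg (a - c))
    (pair_weight_three hb hd he (by linarith))
  have had := mul_nonneg (sq_nonneg (a - d))
    (pair_weight_three hb hc he (by linarith))
  have hae := mul_nonneg (sq_nonneg (a - e))
    (pair_weight_three hb hc hd (by linarith))
  have hbc := mul_nonneg (sq_nonneg (b - c))
    (pair_weight_three ha hd he (by linarith))
  have hbd := mul_nonneg (sq_nonneg (b - d))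
    (pair_weight_three ha hc he (by linarith))
  have hbe := mul_nonneg (sq_nonneg (b - e))
    (pair_weight_three ha hc hd (by linarith))
  have hcd := mul_nonneg (sq_nonneg (c - d))
    (pair_weight_three ha hb he (by linarith))
  have hce := mul_nonneg (sq_nonneg (c - e))
    (pair_weight_three ha hb hd (by linarith))
  have hde := mul_nonneg (sq_nonneg (d - e))
    (pair_weight_three ha hb hc (by linarith))
  -- The gap in Maclaurin's inequality as a sum of squares. As polynomials the two sides differ by a
  -- multiple of `a + b + c + d + e - 1`.
  have hid : 24 / 125 - 12 / 5 * (
        a * b * c + a * b * d + a * b * e + a * c * d + a * c * e + a * d * e + b * c * d +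
        b * c * e + b * d * e + c * d * e) =
      (a - b) ^ 2 * (6 / 125 + 4 / 25 * (c + d + e)) +
      (a - c) ^ 2 * (6 / 125 + 4 / 25 * (b + d + e)) +
      (a - d) ^ 2 * (6 / 125 + 4 / 25 * (b + c + e)) +
      (a - e) ^ 2 * (6 / 125 + 4 / 25 * (b + c + d)) +
      (b - c) ^ 2 * (6 / 125 + 4 / 25 * (a + d + e)) +
      (b - d) ^ 2 * (6 / 125 + 4 / 25 * (a + c + e)) +
      (b - e) ^ 2 * (6 / 125 + 4 / 25 * (a + c + d)) +
      (c - d) ^ 2 * (6 / 125 + 4 / 25 * (a + b + e)) +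
      (c - e) ^ 2 * (6 / 125 + 4 / 25 * (a + b + d)) +
      (d - e) ^ 2 * (6 / 125 + 4 / 25 * (a + b + c)) := by
    linear_combination -(24 / 125 * (1 + (a + b + c + d + e)) +
      12 / 25 * (a * b + a * c + a * d + a * e + b * c + b * d + b * e + c * d + c * e + d * e)) * h
  linarith

/-- For fixed `p` this is a concave quadratic in `q`, maximised over the whole hyperplane without
using `q ≥ 0`. The maximum is `12 / 5` times the cubic symmetric function of `p` plus a variance
term, expressed through the differences of the `v`s, each divisible by the matching `p a - p b`. The
value `α = 24 / 25` satisfies `α / 20 = 6 / 125`, giving equality in `pair_weight_three` at the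
origin; `24 / 125` is the value at uniform `p` and `q`. -/
theorem hashForm_three_le (p q : Fin 5 → ℝ) (hp : ∀ a, 0 ≤ p a) (hp1 : ∑ a, p a = 1)
    (hq1 : ∑ a, q a = 1) :
    hashForm 3 p q + (24 / 25) * (∑ a, p a * q a - ∑ a, q a ^ 2) ≤ 24 / 125 := by
  -- Each `v` is the coefficient of the corresponding `q` in the form plus `α` times that `p`. It is
  -- kept opaque so that later algebra treats it as an atom.
  obtain ⟨v0, hv0⟩ : ∃ v, v = 6 * (
      p 1 * p 2 * p 3 + p 1 * p 2 * p 4 + p 1 * p 3 * p 4 + p 2 * p 3 * p 4) + (24 / 25) * p 0 := ⟨_, rfl⟩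
  obtain ⟨v1, hv1⟩ : ∃ v, v = 6 * (
      p 0 * p 2 * p 3 + p 0 * p 2 * p 4 + p 0 * p 3 * p 4 + p 2 * p 3 * p 4) + (24 / 25) * p 1 := ⟨_, rfl⟩
  obtain ⟨v2, hv2⟩ : ∃ v, v = 6 * (
      p 0 * p 1 * p 3 + p 0 * p 1 * p 4 + p 0 * p 3 * p 4 + p 1 * p 3 * p 4) + (24 / 25) * p 2 := ⟨_, rfl⟩
  obtain ⟨v3, hv3⟩ : ∃ v, v = 6 * (
      p 0 * p 1 * p 2 + p 0 * p 1 * p 4 + p 0 * p 2 * p 4 + p 1 * p 2 * p 4) + (24 / 25) * p 3 := ⟨_, rfl⟩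
  obtain ⟨v4, hv4⟩ : ∃ v, v = 6 * (
      p 0 * p 1 * p 2 + p 0 * p 1 * p 3 + p 0 * p 2 * p 3 + p 1 * p 2 * p 3) + (24 / 25) * p 4 := ⟨_, rfl⟩
  have hmax := sum_mul_sub_sum_sq_le (show (0 : ℝ) < (24 / 25) by norm_num) q
    ![v0, v1, v2, v3, v4] hq1
  rw [Fin.sum_univ_five] at hp1
  have hbound := weighted_esymm_three_le (hp 0) (hp 1) (hp 2) (hp 3) (hp 4) hp1
  have h01 : v0 - v1 = (p 0 - p 1) * ((24 / 25) - 6 * (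
      p 2 * p 3 + p 2 * p 4 + p 3 * p 4)) := by
    rw [hv0, hv1]; ring
  have h02 : v0 - v2 = (p 0 - p 2) * ((24 / 25) - 6 * (
      p 1 * p 3 + p 1 * p 4 + p 3 * p 4)) := by
    rw [hv0, hv2]; ring
  have h03 : v0 - v3 = (p 0 - p 3) * ((24 / 25) - 6 * (
      p 1 * p 2 + p 1 * p 4 + p 2 * p 4)) := by
    rw [hv0, hv3]; ring
  have h04 : v0 - v4 = (p 0 - p 4) * ((24 / 25) - 6 * (
      p 1 * p 2 + p 1 * p 3 + p 2 * p 3)) := by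
    rw [hv0, hv4]; ring
  have h12 : v1 - v2 = (p 1 - p 2) * ((24 / 25) - 6 * (
      p 0 * p 3 + p 0 * p 4 + p 3 * p 4)) := by
    rw [hv1, hv2]; ring
  have h13 : v1 - v3 = (p 1 - p 3) * ((24 / 25) - 6 * (
      p 0 * p 2 + p 0 * p 4 + p 2 * p 4)) := by
    rw [hv1, hv3]; ring
  have h14 : v1 - v4 = (p 1 - p 4) * ((24 / 25) - 6 * (
      p 0 * p 2 + p 0 * p 3 + p 2 * p 3)) := by
    rw [hv1, hv4]; ring
  have h23 : v2 - v3 = (p 2 - p 3) * ((24 / 25) - 6 * (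
      p 0 * p 1 + p 0 * p 4 + p 1 * p 4)) := by
    rw [hv2, hv3]; ring
  have h24 : v2 - v4 = (p 2 - p 4) * ((24 / 25) - 6 * (
      p 0 * p 1 + p 0 * p 3 + p 1 * p 3)) := by
    rw [hv2, hv4]; ring
  have h34 : v3 - v4 = (p 3 - p 4) * ((24 / 25) - 6 * (
      p 0 * p 1 + p 0 * p 2 + p 1 * p 2)) := by
    rw [hv3, hv4]; ring
  rw [← h01, ← h02, ← h03, ← h04, ← h12, ← h13, ← h14, ← h23, ← h24, ← h34] at hbound
  simp only [Fin.sum_univ_five, Fintype.card_fin] at hmax ⊢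
  have hv : v0 + v1 + v2 + v3 + v4 = 5 * (12 / 5) * (
      p 0 * p 1 * p 2 + p 0 * p 1 * p 3 + p 0 * p 1 * p 4 + p 0 * p 2 * p 3 + p 0 * p 2 * p 4 +
      p 0 * p 3 * p 4 + p 1 * p 2 * p 3 + p 1 * p 2 * p 4 + p 1 * p 3 * p 4 + p 2 * p 3 * p 4) + (24 / 25) := by
    rw [hv0, hv1, hv2, hv3, hv4]; linear_combination (24 / 25) * hp1
  have hvar : v0 ^ 2 + v1 ^ 2 + v2 ^ 2 + v3 ^ 2 + v4 ^ 2 -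
      (v0 + v1 + v2 + v3 + v4) ^ 2 / 5 = 1 / 5 * (
      (v0 - v1) ^ 2 + (v0 - v2) ^ 2 + (v0 - v3) ^ 2 + (v0 - v4) ^ 2 + (v1 - v2) ^ 2 +
      (v1 - v3) ^ 2 + (v1 - v4) ^ 2 + (v2 - v3) ^ 2 + (v2 - v4) ^ 2 + (v3 - v4) ^ 2) := by ring
  have hlin : q 0 * v0 + q 1 * v1 + q 2 * v2 + q 3 * v3 + q 4 * v4 =
      hashForm 3 p q + (24 / 25) * (p 0 * q 0 + p 1 * q 1 + p 2 * q 2 + p 3 * q 3 + p 4 * q 4) := by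
    rw [hashForm_three, hv0, hv1, hv2, hv3, hv4]; ring
  have hmax' : q 0 * v0 + q 1 * v1 + q 2 * v2 + q 3 * v3 + q 4 * v4 -
      (24 / 25) * (q 0 ^ 2 + q 1 ^ 2 + q 2 ^ 2 + q 3 ^ 2 + q 4 ^ 2) ≤
      (v0 + v1 + v2 + v3 + v4 - (24 / 25)) / 5 +
      (v0 ^ 2 + v1 ^ 2 + v2 ^ 2 + v3 ^ 2 + v4 ^ 2 -
      (v0 + v1 + v2 + v3 + v4) ^ 2 / 5) / (4 * (24 / 25)) := hmax
  have hscale : ∀ V : ℝ, 1 / 5 * V / (4 * (24 / 25)) = 5 / 96 * V := fun V => by ring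
  rw [hvar, hv, hscale] at hmax'
  linarith only [hmax', hbound, hlin]

/-- The analogue of `weighted_esymm_three_le` for six variables. -/
theorem weighted_esymm_four_le {a b c d e f : ℝ} (ha : 0 ≤ a) (hb : 0 ≤ b) (hc : 0 ≤ c)
    (hd : 0 ≤ d) (he : 0 ≤ e) (hf : 0 ≤ f) (h : a + b + c + d + e + f = 1) :
    8 * (
        a * b * c * d + a * b * c * e + a * b * c * f + a * b * d * e + a * b * d * f +
        a * b * e * f + a * c * d * e + a * c * d * f + a * c * e * f + a * d * e * f +
        b * c * d * e + b * c * d * f + b * c * e * f + b * d * e * f + c * d * e * f) +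
      3 / 32 * (
        ((a - b) * ((4 / 9) - 24 * (c * d * e + c * d * f + c * e * f + d * e * f))) ^ 2 +
        ((a - c) * ((4 / 9) - 24 * (b * d * e + b * d * f + b * e * f + d * e * f))) ^ 2 +
        ((a - d) * ((4 / 9) - 24 * (b * c * e + b * c * f + b * e * f + c * e * f))) ^ 2 +
        ((a - e) * ((4 / 9) - 24 * (b * c * d + b * c * f + b * d * f + c * d * f))) ^ 2 +
        ((a - f) * ((4 / 9) - 24 * (b * c * d + b * c * e + b * d * e + c * d * e))) ^ 2 +
        ((b - c) * ((4 / 9) - 24 * (a * d * e + a * d * f + a * e * f + d * e * f))) ^ 2 +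
        ((b - d) * ((4 / 9) - 24 * (a * c * e + a * c * f + a * e * f + c * e * f))) ^ 2 +
        ((b - e) * ((4 / 9) - 24 * (a * c * d + a * c * f + a * d * f + c * d * f))) ^ 2 +
        ((b - f) * ((4 / 9) - 24 * (a * c * d + a * c * e + a * d * e + c * d * e))) ^ 2 +
        ((c - d) * ((4 / 9) - 24 * (a * b * e + a * b * f + a * e * f + b * e * f))) ^ 2 +
        ((c - e) * ((4 / 9) - 24 * (a * b * d + a * b * f + a * d * f + b * d * f))) ^ 2 +
        ((c - f) * ((4 / 9) - 24 * (a * b * d + a * b * e + a * d * e + b * d * e))) ^ 2 +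
        ((d - e) * ((4 / 9) - 24 * (a * b * c + a * b * f + a * c * f + b * c * f))) ^ 2 +
        ((d - f) * ((4 / 9) - 24 * (a * b * c + a * b * e + a * c * e + b * c * e))) ^ 2 +
        ((e - f) * ((4 / 9) - 24 * (a * b * c + a * b * d + a * c * d + b * c * d))) ^ 2) ≤ 5 / 54 := by
  have hab := mul_nonneg (sq_nonneg (a - b))
    (pair_weight_four hc hd he hf (by linarith))
  have hac := mul_nonneg (sq_nonneg (a - c))
    (pair_weight_four hb hd he hf (by linarith))
  have had := mul_nonneg (sq_nonneg (a - d))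
    (pair_weight_four hb hc he hf (by linarith))
  have hae := mul_nonneg (sq_nonneg (a - e))
    (pair_weight_four hb hc hd hf (by linarith))
  have haf := mul_nonneg (sq_nonneg (a - f))
    (pair_weight_four hb hc hd he (by linarith))
  have hbc := mul_nonneg (sq_nonneg (b - c))
    (pair_weight_four ha hd he hf (by linarith))
  have hbd := mul_nonneg (sq_nonneg (b - d))
    (pair_weight_four ha hc he hf (by linarith))
  have hbe := mul_nonneg (sq_nonneg (b - e))
    (pair_weight_four ha hc hd hf (by linarith))
  have hbf := mul_nonneg (sq_nonneg (b - f))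
    (pair_weight_four ha hc hd he (by linarith))
  have hcd := mul_nonneg (sq_nonneg (c - d))
    (pair_weight_four ha hb he hf (by linarith))
  have hce := mul_nonneg (sq_nonneg (c - e))
    (pair_weight_four ha hb hd hf (by linarith))
  have hcf := mul_nonneg (sq_nonneg (c - f))
    (pair_weight_four ha hb hd he (by linarith))
  have hde := mul_nonneg (sq_nonneg (d - e))
    (pair_weight_four ha hb hc hf (by linarith))
  have hdf := mul_nonneg (sq_nonneg (d - f))
    (pair_weight_four ha hb hc he (by linarith))
  have hef := mul_nonneg (sq_nonneg (e - f))
    (pair_weight_four ha hb hc hd (by linarith))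
  have hid : 5 / 54 - 8 * (
        a * b * c * d + a * b * c * e + a * b * c * f + a * b * d * e + a * b * d * f +
        a * b * e * f + a * c * d * e + a * c * d * f + a * c * e * f + a * d * e * f +
        b * c * d * e + b * c * d * f + b * c * e * f + b * d * e * f + c * d * e * f) =
      (a - b) ^ 2 * (1 / 54 + 1 / 18 * (c + d + e + f) + 1 / 3 * (c * d + c * e + c * f + d * e + d * f + e * f)) +
      (a - c) ^ 2 * (1 / 54 + 1 / 18 * (b + d + e + f) + 1 / 3 * (b * d + b * e + b * f + d * e + d * f + e * f)) +
      (a - d) ^ 2 * (1 / 54 + 1 / 18 * (b + c + e + f) + 1 / 3 * (b * c + b * e + b * f + c * e + c * f + e * f)) +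
      (a - e) ^ 2 * (1 / 54 + 1 / 18 * (b + c + d + f) + 1 / 3 * (b * c + b * d + b * f + c * d + c * f + d * f)) +
      (a - f) ^ 2 * (1 / 54 + 1 / 18 * (b + c + d + e) + 1 / 3 * (b * c + b * d + b * e + c * d + c * e + d * e)) +
      (b - c) ^ 2 * (1 / 54 + 1 / 18 * (a + d + e + f) + 1 / 3 * (a * d + a * e + a * f + d * e + d * f + e * f)) +
      (b - d) ^ 2 * (1 / 54 + 1 / 18 * (a + c + e + f) + 1 / 3 * (a * c + a * e + a * f + c * e + c * f + e * f)) +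
      (b - e) ^ 2 * (1 / 54 + 1 / 18 * (a + c + d + f) + 1 / 3 * (a * c + a * d + a * f + c * d + c * f + d * f)) +
      (b - f) ^ 2 * (1 / 54 + 1 / 18 * (a + c + d + e) + 1 / 3 * (a * c + a * d + a * e + c * d + c * e + d * e)) +
      (c - d) ^ 2 * (1 / 54 + 1 / 18 * (a + b + e + f) + 1 / 3 * (a * b + a * e + a * f + b * e + b * f + e * f)) +
      (c - e) ^ 2 * (1 / 54 + 1 / 18 * (a + b + d + f) + 1 / 3 * (a * b + a * d + a * f + b * d + b * f + d * f)) +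
      (c - f) ^ 2 * (1 / 54 + 1 / 18 * (a + b + d + e) + 1 / 3 * (a * b + a * d + a * e + b * d + b * e + d * e)) +
      (d - e) ^ 2 * (1 / 54 + 1 / 18 * (a + b + c + f) + 1 / 3 * (a * b + a * c + a * f + b * c + b * f + c * f)) +
      (d - f) ^ 2 * (1 / 54 + 1 / 18 * (a + b + c + e) + 1 / 3 * (a * b + a * c + a * e + b * c + b * e + c * e)) +
      (e - f) ^ 2 * (1 / 54 + 1 / 18 * (a + b + c + d) + 1 / 3 * (a * b + a * c + a * d + b * c + b * d + c * d)) := by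
    linear_combination -(5 / 54 * (1 + (a + b + c + d + e + f)) +
      2 / 9 * (a * b + a * c + a * d + a * e + a * f + b * c + b * d + b * e + b * f + c * d + c * e +
        c * f + d * e + d * f + e * f) +
      (a * b * c + a * b * d + a * b * e + a * b * f + a * c * d + a * c * e + a * c * f +
        a * d * e + a * d * f + a * e * f + b * c * d + b * c * e + b * c * f + b * d * e +
        b * d * f + b * e * f + c * d * e + c * d * f + c * e * f + d * e * f)) * h
  linarith

/-- Same scheme as for five symbols: `α = 4 / 9` satisfies `α / 24 = 1 / 54`, giving equality in
`pair_weight_four` at the origin, and `5 / 54` is the value at uniform `p` and `q`. -/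
theorem hashForm_four_le (p q : Fin 6 → ℝ) (hp : ∀ a, 0 ≤ p a) (hp1 : ∑ a, p a = 1)
    (hq1 : ∑ a, q a = 1) :
    hashForm 4 p q + (4 / 9) * (∑ a, p a * q a - ∑ a, q a ^ 2) ≤ 5 / 54 := by
  obtain ⟨v0, hv0⟩ : ∃ v, v = 24 * (
      p 1 * p 2 * p 3 * p 4 + p 1 * p 2 * p 3 * p 5 + p 1 * p 2 * p 4 * p 5 +
      p 1 * p 3 * p 4 * p 5 + p 2 * p 3 * p 4 * p 5) + (4 / 9) * p 0 := ⟨_, rfl⟩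
  obtain ⟨v1, hv1⟩ : ∃ v, v = 24 * (
      p 0 * p 2 * p 3 * p 4 + p 0 * p 2 * p 3 * p 5 + p 0 * p 2 * p 4 * p 5 +
      p 0 * p 3 * p 4 * p 5 + p 2 * p 3 * p 4 * p 5) + (4 / 9) * p 1 := ⟨_, rfl⟩
  obtain ⟨v2, hv2⟩ : ∃ v, v = 24 * (
      p 0 * p 1 * p 3 * p 4 + p 0 * p 1 * p 3 * p 5 + p 0 * p 1 * p 4 * p 5 +
      p 0 * p 3 * p 4 * p 5 + p 1 * p 3 * p 4 * p 5) + (4 / 9) * p 2 := ⟨_, rfl⟩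
  obtain ⟨v3, hv3⟩ : ∃ v, v = 24 * (
      p 0 * p 1 * p 2 * p 4 + p 0 * p 1 * p 2 * p 5 + p 0 * p 1 * p 4 * p 5 +
      p 0 * p 2 * p 4 * p 5 + p 1 * p 2 * p 4 * p 5) + (4 / 9) * p 3 := ⟨_, rfl⟩
  obtain ⟨v4, hv4⟩ : ∃ v, v = 24 * (
      p 0 * p 1 * p 2 * p 3 + p 0 * p 1 * p 2 * p 5 + p 0 * p 1 * p 3 * p 5 +
      p 0 * p 2 * p 3 * p 5 + p 1 * p 2 * p 3 * p 5) + (4 / 9) * p 4 := ⟨_, rfl⟩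
  obtain ⟨v5, hv5⟩ : ∃ v, v = 24 * (
      p 0 * p 1 * p 2 * p 3 + p 0 * p 1 * p 2 * p 4 + p 0 * p 1 * p 3 * p 4 +
      p 0 * p 2 * p 3 * p 4 + p 1 * p 2 * p 3 * p 4) + (4 / 9) * p 5 := ⟨_, rfl⟩
  have hmax := sum_mul_sub_sum_sq_le (show (0 : ℝ) < (4 / 9) by norm_num) q
    ![v0, v1, v2, v3, v4, v5] hq1
  rw [Fin.sum_univ_six] at hp1
  have hbound := weighted_esymm_four_le (hp 0) (hp 1) (hp 2) (hp 3) (hp 4) (hp 5) hp1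
  have h01 : v0 - v1 = (p 0 - p 1) * ((4 / 9) - 24 * (
      p 2 * p 3 * p 4 + p 2 * p 3 * p 5 + p 2 * p 4 * p 5 + p 3 * p 4 * p 5)) := by
    rw [hv0, hv1]; ring
  have h02 : v0 - v2 = (p 0 - p 2) * ((4 / 9) - 24 * (
      p 1 * p 3 * p 4 + p 1 * p 3 * p 5 + p 1 * p 4 * p 5 + p 3 * p 4 * p 5)) := by
    rw [hv0, hv2]; ring
  have h03 : v0 - v3 = (p 0 - p 3) * ((4 / 9) - 24 * (
      p 1 * p 2 * p 4 + p 1 * p 2 * p 5 + p 1 * p 4 * p 5 + p 2 * p 4 * p 5)) := by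
    rw [hv0, hv3]; ring
  have h04 : v0 - v4 = (p 0 - p 4) * ((4 / 9) - 24 * (
      p 1 * p 2 * p 3 + p 1 * p 2 * p 5 + p 1 * p 3 * p 5 + p 2 * p 3 * p 5)) := by
    rw [hv0, hv4]; ring
  have h05 : v0 - v5 = (p 0 - p 5) * ((4 / 9) - 24 * (
      p 1 * p 2 * p 3 + p 1 * p 2 * p 4 + p 1 * p 3 * p 4 + p 2 * p 3 * p 4)) := by
    rw [hv0, hv5]; ring
  have h12 : v1 - v2 = (p 1 - p 2) * ((4 / 9) - 24 * (
      p 0 * p 3 * p 4 + p 0 * p 3 * p 5 + p 0 * p 4 * p 5 + p 3 * p 4 * p 5)) := by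
    rw [hv1, hv2]; ring
  have h13 : v1 - v3 = (p 1 - p 3) * ((4 / 9) - 24 * (
      p 0 * p 2 * p 4 + p 0 * p 2 * p 5 + p 0 * p 4 * p 5 + p 2 * p 4 * p 5)) := by
    rw [hv1, hv3]; ring
  have h14 : v1 - v4 = (p 1 - p 4) * ((4 / 9) - 24 * (
      p 0 * p 2 * p 3 + p 0 * p 2 * p 5 + p 0 * p 3 * p 5 + p 2 * p 3 * p 5)) := by
    rw [hv1, hv4]; ring
  have h15 : v1 - v5 = (p 1 - p 5) * ((4 / 9) - 24 * (
      p 0 * p 2 * p 3 + p 0 * p 2 * p 4 + p 0 * p 3 * p 4 + p 2 * p 3 * p 4)) := by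
    rw [hv1, hv5]; ring
  have h23 : v2 - v3 = (p 2 - p 3) * ((4 / 9) - 24 * (
      p 0 * p 1 * p 4 + p 0 * p 1 * p 5 + p 0 * p 4 * p 5 + p 1 * p 4 * p 5)) := by
    rw [hv2, hv3]; ring
  have h24 : v2 - v4 = (p 2 - p 4) * ((4 / 9) - 24 * (
      p 0 * p 1 * p 3 + p 0 * p 1 * p 5 + p 0 * p 3 * p 5 + p 1 * p 3 * p 5)) := by
    rw [hv2, hv4]; ring
  have h25 : v2 - v5 = (p 2 - p 5) * ((4 / 9) - 24 * (
      p 0 * p 1 * p 3 + p 0 * p 1 * p 4 + p 0 * p 3 * p 4 + p 1 * p 3 * p 4)) := by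
    rw [hv2, hv5]; ring
  have h34 : v3 - v4 = (p 3 - p 4) * ((4 / 9) - 24 * (
      p 0 * p 1 * p 2 + p 0 * p 1 * p 5 + p 0 * p 2 * p 5 + p 1 * p 2 * p 5)) := by
    rw [hv3, hv4]; ring
  have h35 : v3 - v5 = (p 3 - p 5) * ((4 / 9) - 24 * (
      p 0 * p 1 * p 2 + p 0 * p 1 * p 4 + p 0 * p 2 * p 4 + p 1 * p 2 * p 4)) := by
    rw [hv3, hv5]; ring
  have h45 : v4 - v5 = (p 4 - p 5) * ((4 / 9) - 24 * (
      p 0 * p 1 * p 2 + p 0 * p 1 * p 3 + p 0 * p 2 * p 3 + p 1 * p 2 * p 3)) := by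
    rw [hv4, hv5]; ring
  rw [← h01, ← h02, ← h03, ← h04, ← h05, ← h12, ← h13, ← h14, ← h15, ← h23, ← h24, ← h25, ← h34,
    ← h35, ← h45] at hbound
  simp only [Fin.sum_univ_six, Fintype.card_fin] at hmax ⊢
  have hv : v0 + v1 + v2 + v3 + v4 + v5 = 6 * (8) * (
      p 0 * p 1 * p 2 * p 3 + p 0 * p 1 * p 2 * p 4 + p 0 * p 1 * p 2 * p 5 +
      p 0 * p 1 * p 3 * p 4 + p 0 * p 1 * p 3 * p 5 + p 0 * p 1 * p 4 * p 5 +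
      p 0 * p 2 * p 3 * p 4 + p 0 * p 2 * p 3 * p 5 + p 0 * p 2 * p 4 * p 5 +
      p 0 * p 3 * p 4 * p 5 + p 1 * p 2 * p 3 * p 4 + p 1 * p 2 * p 3 * p 5 +
      p 1 * p 2 * p 4 * p 5 + p 1 * p 3 * p 4 * p 5 + p 2 * p 3 * p 4 * p 5) + (4 / 9) := by
    rw [hv0, hv1, hv2, hv3, hv4, hv5]; linear_combination (4 / 9) * hp1
  have hvar : v0 ^ 2 + v1 ^ 2 + v2 ^ 2 + v3 ^ 2 + v4 ^ 2 + v5 ^ 2 -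
      (v0 + v1 + v2 + v3 + v4 + v5) ^ 2 / 6 = 1 / 6 * (
      (v0 - v1) ^ 2 + (v0 - v2) ^ 2 + (v0 - v3) ^ 2 + (v0 - v4) ^ 2 + (v0 - v5) ^ 2 +
      (v1 - v2) ^ 2 + (v1 - v3) ^ 2 + (v1 - v4) ^ 2 + (v1 - v5) ^ 2 + (v2 - v3) ^ 2 +
      (v2 - v4) ^ 2 + (v2 - v5) ^ 2 + (v3 - v4) ^ 2 + (v3 - v5) ^ 2 + (v4 - v5) ^ 2) := by ring
  have hlin : q 0 * v0 + q 1 * v1 + q 2 * v2 + q 3 * v3 + q 4 * v4 + q 5 * v5 =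
      hashForm 4 p q + (4 / 9) * (p 0 * q 0 + p 1 * q 1 + p 2 * q 2 + p 3 * q 3 + p 4 * q 4 + p 5 * q 5) := by
    rw [hashForm_four, hv0, hv1, hv2, hv3, hv4, hv5]; ring
  have hmax' : q 0 * v0 + q 1 * v1 + q 2 * v2 + q 3 * v3 + q 4 * v4 + q 5 * v5 -
      (4 / 9) * (q 0 ^ 2 + q 1 ^ 2 + q 2 ^ 2 + q 3 ^ 2 + q 4 ^ 2 + q 5 ^ 2) ≤
      (v0 + v1 + v2 + v3 + v4 + v5 - (4 / 9)) / 6 +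
      (v0 ^ 2 + v1 ^ 2 + v2 ^ 2 + v3 ^ 2 + v4 ^ 2 + v5 ^ 2 -
      (v0 + v1 + v2 + v3 + v4 + v5) ^ 2 / 6) / (4 * (4 / 9)) := hmax
  have hscale : ∀ V : ℝ, 1 / 6 * V / (4 * (4 / 9)) = 3 / 32 * V := fun V => by ring
  rw [hvar, hv, hscale] at hmax'
  linarith only [hmax', hbound, hlin]

/-! ### Counting tuples in a subcode. -/

theorem hashForm_smul (m : ℕ) (b c : ℝ) (p q : Fin (m + 2) → ℝ) :
    hashForm m (fun a => b * p a) (fun a => c * q a) = b ^ m * c * hashForm m p q := by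
  unfold hashForm
  rw [Finset.mul_sum]
  refine Finset.sum_congr rfl fun s _ => ?_
  split_ifs
  · rw [Finset.prod_mul_distrib, ← Finset.mul_sum]
    simp
    ring
  · simp

/-- The number of words of `B` with symbol `a` at coordinate `i`. -/
noncomputable def symbolCount {n k : ℕ} (B : Finset (Fin n → Fin k)) (i : Fin n) (a : Fin k) : ℝ :=
  ((B.filter fun w => w i = a).card : ℝ)

open Finset in
theorem sum_symbolCount {n k : ℕ} (B : Finset (Fin n → Fin k)) (i : Fin n) :
    ∑ a, symbolCount B i a = #B := by
  simp only [symbolCount]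
  rw [card_eq_sum_card_fiberwise (f := fun w => w i) (t := univ) fun _ _ => by simp]
  simp

-- Tuples are grouped by the pattern `s` they show at `i`. A pattern occurs for a product of symbol
-- counts of `B`, and the words of `C` avoiding it are sorted by their symbol.
open Finset in
theorem sum_tuples_eq_hashForm {m n : ℕ} (B C : Finset (Fin n → Fin (m + 2))) (i : Fin n) :
    ∑ x ∈ Fintype.piFinset (fun _ : Fin m => B),
      (if Function.Injective (fun j => x j i) then (#{y ∈ C | ∀ j, y i ≠ x j i} : ℝ) else 0) =
    hashForm m (symbolCount B i) (symbolCount C i) := by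
  classical
  rw [← sum_fiberwise_of_maps_to (t := univ) (g := fun x j => x j i) fun _ _ => mem_univ _,
    hashForm]
  refine sum_congr rfl fun s _ => ?_
  have hfib : ∀ x ∈ (Fintype.piFinset (fun _ : Fin m => B)).filter (fun x => (fun j => x j i) = s),
      (if Function.Injective (fun j => x j i) then (#{y ∈ C | ∀ j, y i ≠ x j i} : ℝ) else 0) =
        if Function.Injective s then (#{y ∈ C | ∀ j, y i ≠ s j} : ℝ) else 0 := by
    intro x hx
    obtain rfl := (mem_filter.1 hx).2
    rfl
  rw [sum_congr rfl hfib, sum_const, nsmul_eq_mul]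
  have hcard : #((Fintype.piFinset (fun _ : Fin m => B)).filter (fun x => (fun j => x j i) = s)) =
      ∏ j, #(B.filter fun w => w i = s j) := by
    rw [← Fintype.card_piFinset]
    congr 1
    ext x
    simp [Fintype.mem_piFinset, funext_iff, forall_and]
  have hfree : (#{y ∈ C | ∀ j, y i ≠ s j} : ℝ) =
      ∑ a with ∀ j, a ≠ s j, symbolCount C i a := by
    rw [card_eq_sum_card_fiberwise (f := fun y => y i) (t := univ.filter fun a => ∀ j, a ≠ s j)
      fun y hy => by simpa using (mem_filter.1 hy).2]
    push_cast
    refine sum_congr rfl fun a ha => ?_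
    rw [symbolCount, filter_filter]
    congr 2
    ext y
    have ha' := (mem_filter.1 ha).2
    simp only [mem_filter]
    constructor
    · exact fun h => ⟨h.1, h.2.2⟩
    · rintro ⟨h1, rfl⟩
      exact ⟨h1, ha', rfl⟩
  rw [hcard]
  split_ifs
  · rw [hfree]
    simp [symbolCount]
  · simp

open Finset in
theorem descFactorial_le_card_injective_tuples {α : Type*} [DecidableEq α] (m : ℕ)
    (B : Finset α) :
    (#B).descFactorial m ≤
      #((Fintype.piFinset (fun _ : Fin m => B)).filter fun x => Function.Injective x) := by
  have hcard : Fintype.card (Fin m ↪ B) = (#B).descFactorial m := by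
    rw [Fintype.card_embedding_eq, Fintype.card_fin, Fintype.card_coe]
  rw [← hcard, ← card_univ]
  refine card_le_card_of_injOn (fun e j => (e j : α)) ?_ ?_
  · intro e _
    simp only [coe_filter, Fintype.mem_piFinset, Set.mem_ofPred_eq]
    exact ⟨fun j => (e j).2, Subtype.val_injective.comp e.injective⟩
  · intro e _ e' _ h
    ext j
    exact congrFun h j

/-- Almost all `m`-tuples of a large set are injective. For `b ≤ m ^ 2` the left side is not
positive, so small subcodes need no separate treatment when averaging. -/
theorem pow_mul_sub_sq_le_mul_descFactorial (b m : ℕ) :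
    (b : ℝ) ^ m * (b - (m : ℝ) ^ 2) ≤ b * (b.descFactorial m : ℝ) := by
  induction m with
  | zero => simp
  | succ m ih =>
    rw [Nat.descFactorial_succ]
    push_cast
    rcases lt_or_ge b m with h | h
    · have h1 : (b : ℝ) - ((m : ℝ) + 1) ^ 2 ≤ 0 := by
        have : (b : ℝ) < m := by exact_mod_cast h
        nlinarith [(Nat.cast_nonneg m : (0 : ℝ) ≤ m)]
      exact (mul_nonpos_of_nonneg_of_nonpos (by positivity) h1).trans (by positivity)
    · have h0 : (0 : ℝ) ≤ b - m := by
        rw [sub_nonneg]; exact_mod_cast h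
      have h1 := mul_le_mul_of_nonneg_left ih h0
      rw [Nat.cast_sub h]
      have h2 : (b : ℝ) ^ m * (b * (b - ((m : ℝ) + 1) ^ 2)) ≤
          (b : ℝ) ^ m * ((b - m) * (b - (m : ℝ) ^ 2)) := by
        refine mul_le_mul_of_nonneg_left ?_ (by positivity)
        have hm : (0 : ℝ) ≤ m := Nat.cast_nonneg m
        have hb : (0 : ℝ) ≤ b := Nat.cast_nonneg b
        nlinarith [mul_nonneg hb hm, pow_nonneg hm 3]
      calc _ = (b : ℝ) ^ m * (b * (b - ((m : ℝ) + 1) ^ 2)) := by ring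
        _ ≤ _ := h2
        _ = (b - m) * ((b : ℝ) ^ m * (b - (m : ℝ) ^ 2)) := by ring
        _ ≤ _ := h1
        _ = _ := by ring

open Finset in
/-- Averaging Hansel's lemma over the `m`-tuples of a subcode `B` whose words take fewer than `m`
symbols at each coordinate of `J`. -/
theorem IsPerfectHash.sum_subcode_le {m n : ℕ} {C : Finset (Fin n → Fin (m + 2))}
    (hC : IsPerfectHash (m + 2) n C) (hN : m < #C) (J : Finset (Fin n))
    {B : Finset (Fin n → Fin (m + 2))} (hB : B ⊆ C) (b : Fin n → Finset (Fin (m + 2)))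
    (hb : ∀ i ∈ J, #(b i) < m) (hBb : ∀ w ∈ B, ∀ i, w i ∈ b i) :
    (#B - (m : ℝ) ^ 2) * (((#C : ℝ) - m) * Real.logb 2 ((#C : ℝ) - m)) ≤
      ∑ i ∈ Jᶜ, #B * #C *
        hashForm m (fun a => symbolCount B i a / #B) (fun a => symbolCount C i a / #C) := by
  classical
  set K := ((#C : ℝ) - m) * Real.logb 2 ((#C : ℝ) - m) with hK
  have hN1 : (1 : ℝ) ≤ #C - m := by
    have : ((m + 1 : ℕ) : ℝ) ≤ #C := by exact_mod_cast hN
    push_cast at this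
    linarith
  have hK0 : 0 ≤ K := mul_nonneg (by linarith) (Real.logb_nonneg (by norm_num) hN1)
  rcases B.eq_empty_or_nonempty with rfl | hBne
  · simp only [card_empty, Nat.cast_zero, zero_mul, sum_const_zero, zero_sub]
    exact mul_nonpos_of_nonpos_of_nonneg (by simp) hK0
  have hBpos : (0 : ℝ) < #B := by exact_mod_cast hBne.card_pos
  have hCpos : (0 : ℝ) < #C := by linarith [(Nat.cast_nonneg m : (0 : ℝ) ≤ m)]
  have hform : ∀ i, hashForm m (symbolCount B i) (symbolCount C i) = (#B : ℝ) ^ m * #C *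
      hashForm m (fun a => symbolCount B i a / #B) (fun a => symbolCount C i a / #C) := by
    intro i
    rw [← hashForm_smul]
    congr 1 <;> ext a <;> field_simp
  set T : (Fin m → Fin n → Fin (m + 2)) → Fin n → ℝ := fun x i =>
    if Function.Injective (fun j => x j i) then (#{y ∈ C | ∀ j, y i ≠ x j i} : ℝ) else 0 with hT
  have hT0 : ∀ x i, 0 ≤ T x i := fun x i => by
    simp only [hT]; split_ifs <;> positivity
  -- Pigeonhole: on `J` there are fewer than `m` available symbols for `m` words.
  have hTJ : ∀ x ∈ Fintype.piFinset (fun _ : Fin m => B), ∀ i ∈ J, T x i = 0 := by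
    intro x hx i hi
    refine if_neg fun hinj => ?_
    have h1 : #(univ.image fun j => x j i) ≤ #(b i) := card_le_card fun a ha => by
      obtain ⟨j, _, rfl⟩ := mem_image.1 ha
      exact hBb _ (Fintype.mem_piFinset.1 hx j) i
    rw [card_image_of_injective _ hinj, card_univ, Fintype.card_fin] at h1
    exact absurd (hb i hi) (not_lt.2 h1)
  have hsum : ((#B).descFactorial m : ℝ) * K ≤
      ∑ x ∈ Fintype.piFinset (fun _ : Fin m => B), ∑ i, T x i := by
    calc ((#B).descFactorial m : ℝ) * K
        ≤ #((Fintype.piFinset (fun _ : Fin m => B)).filter fun x => Function.Injective x) * K :=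
          mul_le_mul_of_nonneg_right
            (by exact_mod_cast descFactorial_le_card_injective_tuples m B) hK0
      _ = ∑ x ∈ (Fintype.piFinset (fun _ : Fin m => B)).filter fun x => Function.Injective x, K := by
          rw [sum_const, nsmul_eq_mul]
      _ ≤ ∑ x ∈ (Fintype.piFinset (fun _ : Fin m => B)).filter fun x => Function.Injective x,
            ∑ i, T x i := by
          refine sum_le_sum fun x hx => ?_
          rw [mem_filter, Fintype.mem_piFinset] at hx
          exact hC.card_sub_mul_logb_le x hx.2 fun j => hB (hx.1 j)
      _ ≤ _ := sum_le_sum_of_subset_of_nonneg (filter_subset _ _)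
          fun x _ _ => sum_nonneg fun i _ => hT0 x i
  have hsplit : ∑ x ∈ Fintype.piFinset (fun _ : Fin m => B), ∑ i, T x i =
      ∑ i ∈ Jᶜ, hashForm m (symbolCount B i) (symbolCount C i) := by
    rw [sum_comm, ← sum_compl_add_sum J]
    have hz : ∑ i ∈ J, ∑ x ∈ Fintype.piFinset (fun _ : Fin m => B), T x i = 0 :=
      sum_eq_zero fun i hi => sum_eq_zero fun x hx => hTJ x hx i hi
    rw [hz, add_zero]
    exact sum_congr rfl fun i _ => sum_tuples_eq_hashForm B C i
  rw [hsplit] at hsum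
  have hdesc := mul_le_mul_of_nonneg_right (pow_mul_sub_sq_le_mul_descFactorial (#B) m) hK0
  have hfin : (#B : ℝ) ^ m * ((#B - (m : ℝ) ^ 2) * K) ≤ (#B : ℝ) ^ m * ∑ i ∈ Jᶜ, #B * #C *
        hashForm m (fun a => symbolCount B i a / #B) (fun a => symbolCount C i a / #C) := by
    calc (#B : ℝ) ^ m * ((#B - (m : ℝ) ^ 2) * K)
        = (#B : ℝ) ^ m * (#B - (m : ℝ) ^ 2) * K := by ring
      _ ≤ #B * ((#B).descFactorial m : ℝ) * K := hdesc
      _ = #B * (((#B).descFactorial m : ℝ) * K) := by ring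
      _ ≤ #B * ∑ i ∈ Jᶜ, hashForm m (symbolCount B i) (symbolCount C i) :=
          mul_le_mul_of_nonneg_left hsum hBpos.le
      _ = _ := by
          simp only [hform, mul_sum]
          exact sum_congr rfl fun i _ => by ring
  exact le_of_mul_le_mul_left hfin (by positivity)

/-! ### Averaging over boxes. -/

open Finset in
/-- Bounding the average of `hashForm` over subcodes by means of a quadratic certificate. -/
theorem sum_mul_hashForm_le {m : ℕ} {α M : ℝ}
    (hM : ∀ p q : Fin (m + 2) → ℝ, (∀ a, 0 ≤ p a) → ∑ a, p a = 1 → ∑ a, q a = 1 →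
      hashForm m p q + α * (∑ a, p a * q a - ∑ a, q a ^ 2) ≤ M)
    {β : Type*} (s : Finset β) (w : β → ℝ) (hw : ∀ t ∈ s, 0 ≤ w t) (p : β → Fin (m + 2) → ℝ)
    (hp : ∀ t ∈ s, ∀ a, 0 ≤ p t a) (hp1 : ∀ t ∈ s, w t ≠ 0 → ∑ a, p t a = 1)
    (q : Fin (m + 2) → ℝ) (hq : ∑ a, q a = 1)
    (hmean : ∀ a, ∑ t ∈ s, w t * p t a = (∑ t ∈ s, w t) * q a) :
    ∑ t ∈ s, w t * hashForm m (p t) q ≤ M * ∑ t ∈ s, w t := by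
  have hterm : ∀ t ∈ s, w t * hashForm m (p t) q ≤
      M * w t - α * (∑ a, w t * p t a * q a - w t * ∑ a, q a ^ 2) := by
    intro t ht
    -- At zero weight `p t` need not be a distribution: an empty subcode yields `0 / 0 = 0`.
    rcases eq_or_ne (w t) 0 with h | h
    · simp [h]
    · have := mul_le_mul_of_nonneg_left (hM (p t) q (hp t ht) (hp1 t ht h) hq) (hw t ht)
      have e : ∑ a, w t * p t a * q a = w t * ∑ a, p t a * q a := by
        rw [mul_sum]; exact sum_congr rfl fun a _ => by ring
      rw [e]
      linarith
  refine (sum_le_sum hterm).trans (le_of_eq ?_)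
  -- Because the weighted mean of `p t` is `q`, the correction terms multiplied by `α` cancel in
  -- total.
  have e : ∑ t ∈ s, ∑ a, w t * p t a * q a = (∑ t ∈ s, w t) * ∑ a, q a ^ 2 := by
    rw [sum_comm, mul_sum]
    refine sum_congr rfl fun a _ => ?_
    rw [← sum_mul, hmean]
    ring
  rw [sum_sub_distrib, ← mul_sum, ← mul_sum, sum_sub_distrib, e, ← sum_mul]
  ring

open Finset in
/-- The main estimate for a perfect hash code, from averaging over all the subcodes cut out by
boxes with sides in `𝒮` on the coordinates in `J`. -/
theorem IsPerfectHash.card_bound {m n : ℕ} {C : Finset (Fin n → Fin (m + 2))}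
    (hC : IsPerfectHash (m + 2) n C) (hN : m < #C) (J : Finset (Fin n))
    (𝒮 : Finset (Finset (Fin (m + 2)))) (h𝒮 : ∀ S ∈ 𝒮, #S < m) (D : ℕ)
    (hD : ∀ a, #{S ∈ 𝒮 | a ∈ S} = D) {α M : ℝ}
    (hM : ∀ p q : Fin (m + 2) → ℝ, (∀ a, 0 ≤ p a) → ∑ a, p a = 1 → ∑ a, q a = 1 →
      hashForm m p q + α * (∑ a, p a * q a - ∑ a, q a ^ 2) ≤ M) :
    ((D : ℝ) ^ #J * #C - (m : ℝ) ^ 2 * (#𝒮 : ℝ) ^ #J) *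
        (((#C : ℝ) - m) * Real.logb 2 ((#C : ℝ) - m)) ≤
      (n - #J) * (M * ((D : ℝ) ^ #J * #C) * #C) := by
  classical
  set boxes : Finset (Fin n → Finset (Fin (m + 2))) :=
    Fintype.piFinset fun i => if i ∈ J then 𝒮 else {univ} with hboxes
  let sub : (Fin n → Finset (Fin (m + 2))) → Finset (Fin n → Fin (m + 2)) := fun b =>
    C.filter fun w => ∀ i, w i ∈ b i
  have hCpos : (0 : ℝ) < #C := by exact_mod_cast (Nat.zero_le m).trans_lt hN
  have hcard : (#boxes : ℝ) = (#𝒮 : ℝ) ^ #J := by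
    have : #boxes = ∏ i, if i ∈ J then #𝒮 else 1 := by
      rw [hboxes, Fintype.card_piFinset]
      exact prod_congr rfl fun i _ => by split_ifs <;> simp
    rw [this, prod_ite_mem]
    simp
  -- Each word lies in the same number of boxes, so box averages reproduce the statistics of `C`, in
  -- particular its symbol distribution at every coordinate.
  have hcover : ∀ w : Fin n → Fin (m + 2), #(boxes.filter fun b => ∀ i, w i ∈ b i) = D ^ #J := by
    intro w
    have h1 : (boxes.filter fun b => ∀ i, w i ∈ b i) =
        Fintype.piFinset fun i => (if i ∈ J then 𝒮 else {univ}).filter fun S => w i ∈ S := by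
      ext b
      simp [hboxes, Fintype.mem_piFinset, forall_and]
    have h2 : ∏ i, #((if i ∈ J then 𝒮 else {univ}).filter fun S => w i ∈ S) =
        ∏ i, if i ∈ J then D else 1 := by
      refine prod_congr rfl fun i _ => ?_
      split_ifs
      · exact hD (w i)
      · simp [filter_singleton]
    rw [h1, Fintype.card_piFinset, h2, prod_ite_mem]
    simp
  have hcount : ∀ (P : (Fin n → Fin (m + 2)) → Prop) [DecidablePred P],
      ∑ b ∈ boxes, (#((sub b).filter P) : ℝ) = (D : ℝ) ^ #J * #(C.filter P) := by
    intro P _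
    have h1 : ∀ b, (sub b).filter P = (C.filter P).filter fun w => ∀ i, w i ∈ b i := fun b => by
      simp only [sub, filter_filter, and_comm]
    simp only [h1, card_filter _ (C.filter P), Nat.cast_sum]
    rw [sum_comm]
    have h2 : ∀ w : Fin n → Fin (m + 2), ∑ b ∈ boxes, (((if ∀ i, w i ∈ b i then 1 else 0 : ℕ)) : ℝ) =
        (D : ℝ) ^ #J := fun w => by
      rw [← Nat.cast_sum, ← card_filter, hcover w]
      simp
    simp only [h2, sum_const, nsmul_eq_mul]
    ring
  have htotal : ∑ b ∈ boxes, (#(sub b) : ℝ) = (D : ℝ) ^ #J * #C := by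
    simpa using hcount fun _ => True
  have hsub := sum_le_sum fun b (hb : b ∈ boxes) =>
    hC.sum_subcode_le hN J (B := sub b) (filter_subset _ _) b
      (fun i hi => by
        have := Fintype.mem_piFinset.1 hb i
        rw [if_pos hi] at this
        exact h𝒮 _ this)
      (fun w hw => (mem_filter.1 hw).2)
  rw [← sum_mul, sum_sub_distrib, htotal, sum_const, nsmul_eq_mul, hcard, mul_comm _ ((m : ℝ) ^ 2),
    sum_comm] at hsub
  refine hsub.trans ?_
  have hcoord : ∀ i ∈ Jᶜ, ∑ b ∈ boxes, (#(sub b) : ℝ) * #C *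
      hashForm m (fun a => symbolCount (sub b) i a / #(sub b)) (fun a => symbolCount C i a / #C) ≤
      M * ((D : ℝ) ^ #J * #C) * #C := by
    intro i _
    have h := sum_mul_hashForm_le hM boxes (fun b => (#(sub b) : ℝ)) (fun b _ => by positivity)
      (fun b a => symbolCount (sub b) i a / #(sub b))
      (fun b _ a => by unfold symbolCount; positivity)
      (fun b _ hb => by rw [← sum_div, sum_symbolCount, div_self hb])
      (fun a => symbolCount C i a / #C)
      (by rw [← sum_div, sum_symbolCount, div_self hCpos.ne'])
      (fun a => by
        have h1 : ∀ b ∈ boxes, (#(sub b) : ℝ) * (symbolCount (sub b) i a / #(sub b)) =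
            symbolCount (sub b) i a := by
          intro b _
          rcases eq_or_ne (#(sub b) : ℝ) 0 with h0 | h0
          · have : sub b = ∅ := by simpa using h0
            simp [this, symbolCount]
          · field_simp
        rw [sum_congr rfl h1, htotal]
        simp only [symbolCount]
        rw [hcount fun w => w i = a]
        field_simp)
    rw [htotal] at h
    calc _ = (∑ b ∈ boxes, (#(sub b) : ℝ) * hashForm m
          (fun a => symbolCount (sub b) i a / #(sub b)) (fun a => symbolCount C i a / #C)) * #C := by
          rw [sum_mul]
          exact sum_congr rfl fun b _ => by ring
      _ ≤ _ := mul_le_mul_of_nonneg_right h hCpos.le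
  refine (sum_le_sum hcoord).trans (le_of_eq ?_)
  rw [sum_const, nsmul_eq_mul, card_compl, Fintype.card_fin,
    Nat.cast_sub (by simpa using card_le_univ J)]

/-! ### Asymptotics and the choice of parameters. -/

theorem eventually_const_mul_two_rpow_le (c : ℝ) {s r : ℝ} (h : s < r) :
    ∀ᶠ n : ℕ in Filter.atTop, c * (2 : ℝ) ^ (s * n) ≤ (2 : ℝ) ^ (r * n) := by
  have h1 : (1 : ℝ) < 2 ^ (r - s) := Real.one_lt_rpow (by norm_num) (by linarith)
  filter_upwards [(tendsto_pow_atTop_atTop_of_one_lt h1).eventually_ge_atTop c] with n hn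
  rw [← Real.rpow_natCast, ← Real.rpow_mul (by norm_num)] at hn
  calc c * (2 : ℝ) ^ (s * n) ≤ (2 : ℝ) ^ ((r - s) * n) * (2 : ℝ) ^ (s * n) :=
        mul_le_mul_of_nonneg_right hn (by positivity)
    _ = (2 : ℝ) ^ (r * n) := by
        rw [← Real.rpow_add (by norm_num)]; congr 1; ring

theorem eventually_add_le_mul_natCast (c : ℝ) {a b : ℝ} (h : a < b) :
    ∀ᶠ n : ℕ in Filter.atTop, a * n + c < b * n := by
  have h1 := (tendsto_natCast_atTop_atTop (R := ℝ)).const_mul_atTop (sub_pos.2 h)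
  filter_upwards [h1.eventually_gt_atTop c] with n hn
  linarith

theorem pow_div_le_two_rpow {K s : ℝ} (hK : 1 ≤ K) {u v : ℕ} (hv : 0 < v)
    (h : K ^ u ≤ (2 : ℝ) ^ (s * v)) (n : ℕ) : K ^ (n * u / v) ≤ (2 : ℝ) ^ (s * n) := by
  have hv' : (0 : ℝ) < v := by exact_mod_cast hv
  calc K ^ (n * u / v) = K ^ ((n * u / v : ℕ) : ℝ) := (Real.rpow_natCast _ _).symm
    _ ≤ K ^ ((u : ℝ) * (n / v)) := by
        refine Real.rpow_le_rpow_of_exponent_le hK (Nat.cast_div_le.trans (le_of_eq ?_))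
        push_cast
        ring
    _ = (K ^ u) ^ ((n : ℝ) / v) := by
        rw [Real.rpow_mul (by linarith), Real.rpow_natCast]
    _ ≤ ((2 : ℝ) ^ (s * v)) ^ ((n : ℝ) / v) :=
        Real.rpow_le_rpow (by positivity) h (by positivity)
    _ = (2 : ℝ) ^ (s * n) := by
        rw [← Real.rpow_mul (by norm_num)]
        congr 1
        field_simp

-- Take `#J = ⌊n u / v⌋`. The average box subcode has size `N / K ^ #J` with `K = #𝒮 / D`, and `hK`
-- with `s < r` makes this exponentially large when `N > 2 ^ (r n)`. The main estimate then forces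
-- about `r ≤ M (1 - u / v)`, contradicting `hr`, whose factor `(999 / 1000) ^ 2` absorbs the
-- lower-order losses.
open Finset in
theorem eventually_card_le_two_rpow {m : ℕ} (𝒮 : Finset (Finset (Fin (m + 2))))
    (h𝒮 : ∀ S ∈ 𝒮, #S < m) (D : ℕ) (hD0 : 0 < D) (hD : ∀ a, #{S ∈ 𝒮 | a ∈ S} = D) {α M : ℝ}
    (hM0 : 0 ≤ M)
    (hM : ∀ p q : Fin (m + 2) → ℝ, (∀ a, 0 ≤ p a) → ∑ a, p a = 1 → ∑ a, q a = 1 →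
      hashForm m p q + α * (∑ a, p a * q a - ∑ a, q a ^ 2) ≤ M)
    {r s : ℝ} (hs : s < r) (hr0 : 0 < r) {u v : ℕ} (hv : 0 < v) (huv : u ≤ v)
    (hK : ((#𝒮 : ℝ) / D) ^ u ≤ (2 : ℝ) ^ (s * v))
    (hr : M * (1 - u / v) < (999 / 1000) ^ 2 * r) :
    ∀ᶠ n : ℕ in Filter.atTop, ∀ C, IsPerfectHash (m + 2) n C → (#C : ℝ) ≤ (2 : ℝ) ^ (r * n) := by
  have hD' : (0 : ℝ) < D := by exact_mod_cast hD0
  have hv' : (0 : ℝ) < v := by exact_mod_cast hv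
  have hK1 : 1 ≤ (#𝒮 : ℝ) / D := by
    rw [one_le_div hD', ← hD 0]
    exact_mod_cast card_filter_le _ _
  -- The first two conditions make the corrections at most `N / 1000`. In the third, `M` pays for
  -- rounding `#J` down and `(999 / 1000) ^ 2` for replacing `log₂ (N - m)` by `r n - 1`.
  filter_upwards [eventually_const_mul_two_rpow_le ((m : ℝ) * 1000) hr0,
    eventually_const_mul_two_rpow_le ((m : ℝ) ^ 2 * 1000) hs,
    eventually_add_le_mul_natCast (M + (999 / 1000) ^ 2) hr,
    eventually_add_le_mul_natCast 1 hr0] with n h1 h2 h3 h4 C hC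
  by_contra! hlt
  simp only [zero_mul, Real.rpow_zero, mul_one, zero_add] at h1 h4
  set N : ℝ := (#C : ℝ) with hN
  set ℓ := n * u / v with hℓ
  set K := (#𝒮 : ℝ) / D with hKdef
  have hx : 0 < (2 : ℝ) ^ (r * n) := by positivity
  have hm0 : (0 : ℝ) ≤ m := Nat.cast_nonneg m
  have hmN : m < #C := by
    have : (m : ℝ) < N := by linarith
    rw [hN] at this
    exact_mod_cast this
  have hℓn : ℓ ≤ n := Nat.div_le_of_le_mul (by rw [mul_comm v]; exact Nat.mul_le_mul_left n huv)
  have hℓ' : (n : ℝ) - ℓ ≤ (1 - u / v) * n + 1 := by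
    have h : (n : ℝ) * u / v < ℓ + 1 := by
      rw [div_lt_iff₀ hv']
      have := Nat.lt_mul_div_succ (n * u) hv
      rw [mul_comm v] at this
      exact_mod_cast this
    have e : (1 - (u : ℝ) / v) * n = n - n * u / v := by ring
    rw [e]
    linarith
  obtain ⟨J, -, hJ⟩ := exists_subset_card_eq (s := (univ : Finset (Fin n))) (n := ℓ) (by simpa)
  have hmain := hC.card_bound hmN J 𝒮 h𝒮 D hD hM
  rw [hJ, ← hN] at hmain
  have hKℓ : K ^ ℓ ≤ (2 : ℝ) ^ (s * n) := pow_div_le_two_rpow hK1 hv hK n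
  have hA : (#𝒮 : ℝ) ^ ℓ = (D : ℝ) ^ ℓ * K ^ ℓ := by
    rw [← mul_pow, hKdef, mul_div_cancel₀ _ hD'.ne']
  have hDℓ : 0 < (D : ℝ) ^ ℓ := by positivity
  have hb1 : 999 / 1000 * N ≤ N - (m : ℝ) ^ 2 * K ^ ℓ := by
    have := mul_le_mul_of_nonneg_left hKℓ (sq_nonneg (m : ℝ))
    linarith
  have hb2 : 999 / 1000 * N ≤ N - m := by linarith
  have hlog : r * n - 1 ≤ Real.logb 2 (N - m) := by
    rw [Real.le_logb_iff_rpow_le (by norm_num) (by linarith), Real.rpow_sub_one (by norm_num)]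
    linarith
  have hN0 : 0 < N := by linarith
  have hcancel : (N - (m : ℝ) ^ 2 * K ^ ℓ) * ((N - m) * Real.logb 2 (N - m)) ≤
      (n - ℓ) * (M * N * N) := by
    refine le_of_mul_le_mul_left ?_ hDℓ
    rw [hA] at hmain
    linarith
  have hlow : (999 / 1000 * N) * ((999 / 1000 * N) * (r * n - 1)) ≤
      (N - (m : ℝ) ^ 2 * K ^ ℓ) * ((N - m) * Real.logb 2 (N - m)) := by
    have hrn : 0 ≤ r * n - 1 := by linarith
    have : 0 ≤ N - m := by linarith
    gcongr
    linarith
  have hup : ((n : ℝ) - ℓ) * (M * N * N) ≤ ((1 - u / v) * n + 1) * (M * N * N) :=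
    mul_le_mul_of_nonneg_right hℓ' (by positivity)
  have hfin : N ^ 2 * ((999 / 1000) ^ 2 * (r * n - 1)) ≤ N ^ 2 * (M * ((1 - u / v) * n + 1)) := by
    linarith
  have := le_of_mul_le_mul_left hfin (by positivity)
  linarith

theorem hashRate_le_of_eventually {k : ℕ} {r : ℝ} (hr : 0 ≤ r)
    (h : ∀ᶠ n : ℕ in Filter.atTop, ∀ C, IsPerfectHash k n C → (C.card : ℝ) ≤ (2 : ℝ) ^ (r * n)) :
    hashRate k ≤ r := by
  classical
  refine Filter.limsup_le_of_le
    (Filter.IsCoboundedUnder.of_frequently_ge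
      (Filter.Frequently.of_forall fun n => maxHashRate_nonneg k n)) ?_
  filter_upwards [h, Filter.eventually_gt_atTop 0] with n hn hn0
  have hn' : (0 : ℝ) < n := by exact_mod_cast hn0
  have hsize : (maxHashSize k n : ℝ) ≤ (2 : ℝ) ^ (r * n) := by
    refine (Nat.le_floor_iff (by positivity)).1 (Finset.sup_le fun C hC => ?_)
    exact Nat.le_floor (hn C (Finset.mem_filter.1 hC).2)
  rw [maxHashRate, div_le_iff₀ hn']
  rcases Nat.eq_zero_or_pos (maxHashSize k n) with h0 | h0
  · rw [h0]
    simpa using by positivity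
  · rwa [Real.logb_le_iff_le_rpow (by norm_num) (by exact_mod_cast h0)]

theorem mainTheorem1 :
    hashRate 5 ≤ 0.1697 ∧ hashRate 6 ≤ 0.0875 := by
  constructor
  -- Pairs of symbols: `K = 10 / 4` and `(5 / 2) ^ 3 = 15.625 ≤ 2 ^ 4`, while `24 / 125 * (22 / 25)
  -- = 0.16896` lies just below `0.1697`.
  · refine hashRate_le_of_eventually (by norm_num) (eventually_card_le_two_rpow (m := 3)
      (Finset.powersetCard 2 Finset.univ)
      (fun S hS => by rw [(Finset.mem_powersetCard.1 hS).2]; norm_num) 4 (by norm_num) (by decide)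
      (by norm_num) hashForm_three_le (s := 4 / 25) (u := 3) (v := 25) (by norm_num) (by norm_num)
      (by norm_num) (by norm_num) ?_ (by norm_num))
    norm_num [Finset.card_powersetCard, Nat.choose]
  -- Triples of symbols: `K = 20 / 10 = 2`, so `s = u / v` is exact, and `5 / 54 * (93 / 100) ≈
  -- 0.0861` lies below `0.0875`.
  · refine hashRate_le_of_eventually (by norm_num) (eventually_card_le_two_rpow (m := 4)
      (Finset.powersetCard 3 Finset.univ)
      (fun S hS => by rw [(Finset.mem_powersetCard.1 hS).2]; norm_num) 10 (by norm_num) (by decide)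
      (by norm_num) hashForm_four_le (s := 7 / 100) (u := 7) (v := 100) (by norm_num) (by norm_num)
      (by norm_num) (by norm_num) ?_ (by norm_num))
    norm_num [Finset.card_powersetCard, Nat.choose]
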